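/- **Setting.** A Fréchet space is a complete, Hausdorff, metrizable, real locally convex space. For Fréchet spaces $E,F$ and $U\subset E$ open, a continuous map $f:U\to F$ is *Keller $C^1$* if for every $x\in U$ the directional derivatives $Df(x)h=\lim_{t\to0}(f(x+th)-f(x))/t$ exist for all $h\in E$ and define a continuous linear map $Df(x)$, and $x\mapsto Df(x)$ is continuous from $U$ to $L(E,F)$ with the topology of uniform convergence on compact sets. A $C^1$-Fréchet manifold is a Hausdorff, second countable manifold modelled on a Fréchet space $F$ whose chart transitions are Keller $C^1$; curves and functionals on it are $C^1$ if they are so in charts, and $x$ is a critical point of a $C^1$-functional $\varphi$ if $\varphi'(x)=0$ on $T_xM$. A (graded) *Finsler structure* on $M$ is a sequence of continuous functions $\|\cdot\|_n:TM\to[0,\infty)$, $n\ge1$, with $\|\cdot\|_n\le\|\cdot\|_{n+1}$, such that on each $T_xM$ the functions $\|\cdot\|_n^x$ are seminorms that define its topology, and such that each point of $M$ lies in the domain $U$ of a chart with the following property, where $T_xM$, $x\in U$, is identified with $F$ by the chart: for all $x_0\in U$ and $k>1$ one has $\frac1k\|v\|_n^{x_0}\le\|v\|_n^{w}\le k\|v\|_n^{x_0}$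 for all $v\in F$, all $n$ and all $w$ in a neighbourhood of $x_0$. Let $\rho_n(x,y)$ be the infimum of $\int\|\sigma'(t)\|_n^{\sigma(t)}\,dt$ over piecewise $C^1$-curves $\sigma$ from $x$ to $y$; the *Finsler metric* is $\rho=\sum_{n\ge1}2^{-n}\frac{\rho_n}{1+\rho_n}$. Put $B_\infty(0_x)=\{h\in T_xM:\|h\|_n^x\le1\text{ for all }n\}$ and $\Phi_\varphi(x)=\inf\{\varphi'(x)h:h\in B_\infty(0_x)\}$. A $C^1$-functional $\varphi$ satisfies $(\mathrm{PS})_c$, $c\in\mathbb R$, if every sequence $(m_i)$ in $M$ with $\varphi(m_i)\to c$ and $\Phi_\varphi(m_i)\to0$ has a convergent subsequence. Let $S_0\subset S$ and $C$ be nonempty subsets of $M$, let $\gamma:S_0\to M$ be continuous and let $H=\{h\in C(S,M):h|_{S_0}=\gamma\}$. Then $\{S_0,S,C\}$ is a *linking set through $\gamma$* if $\gamma(S_0)\cap C=\emptyset$ and $h(S)\cap C\neq\emptyset$ for all $h\in H$. **Theorem.** Let $M$ be a connected $C^1$-Fréchet manifold with a graded Finsler structure whose Finsler metric $\rho$ is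 complete, and let $\varphi:M\to\mathbb R$ be a $C^1$-functional that is a closed map (images of closed sets are closed). Let $\{S_0,S,C\}$ be a linking set through $\gamma$ with $C$ closed and $\rho(\gamma(S_0),C)=\inf\{\rho(x,y):x\in\gamma(S_0),\,y\in C\}>0$. Suppose that $\sup_{\gamma(S_0)}\varphi\le\inf_C\varphi$, that $$c:=\inf_{h\in H}\ \sup_{x\in S}\varphi(h(x))$$ is a real number (with $\inf\emptyset=+\infty$), and that $\varphi$ satisfies $(\mathrm{PS})_c$. Then $c$ is a critical value of $\varphi$, that is, $\varphi$ has a critical point at level $c$, and $c\ge\inf_C\varphi$. Moreover, if $c=\inf_C\varphi$, then $\varphi$ has a critical point at level $c$ that lies in $C$. -/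

import Mathlib

open Set Filter Topology

noncomputable section

/-! ### Keller `C¹` maps between real topological vector spaces -/

section Keller

variable {E F : Type*}
  [AddCommGroup E] [Module ℝ E] [TopologicalSpace E]
  [AddCommGroup F] [Module ℝ F] [TopologicalSpace F]

/-- The continuous linear map `L` gives all directional derivatives of `f` at `x`:
`L h = lim_{t → 0} (f (x + t h) - f x) / t` for every `h`. -/
def HasDirDeriv (f : E → F) (L : E →L[ℝ] F) (x : E) : Prop :=
  ∀ h : E, Tendsto (fun t : ℝ => t⁻¹ • (f (x + t • h) - f x)) (𝓝[≠] 0) (𝓝 (L h))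

open Classical in
/-- The derivative `D f (x) ∈ L(E, F)` (set to `0` when it does not exist). -/
def dirDeriv (f : E → F) (x : E) : E →L[ℝ] F :=
  if h : ∃ L : E →L[ℝ] F, HasDirDeriv f L x then h.choose else 0

/-- `f` is a Keller `C¹`-map on the open set `U`: it is continuous, all its directional
derivatives exist and are given by continuous linear maps, and `x ↦ D f (x)` is continuous from
`U` to `L(E, F)` with the topology of uniform convergence on compact sets. -/
structure KellerC1On [IsTopologicalAddGroup F] (f : E → F) (U : Set E) : Prop where
  continuousOn : ContinuousOn f U
  hasDirDeriv : ∀ x ∈ U, ∃ L : E →L[ℝ] F, HasDirDeriv f L x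
  continuousOn_deriv : ContinuousOn
    (fun x => UniformConvergenceCLM.ofFun (RingHom.id ℝ) F {K : Set E | IsCompact K}
      (dirDeriv f x)) U

end Keller

/-! ### `C¹`-Fréchet manifolds, tangent vectors and Finsler structures -/

section Manifold

variable (F : Type*) [AddCommGroup F] [Module ℝ F] [TopologicalSpace F]
  [IsTopologicalAddGroup F]
variable (M : Type*) [TopologicalSpace M] [ChartedSpace F M]

/-- All coordinate transitions of the atlas of `M` are Keller `C¹`-maps. -/
def IsKellerC1Manifold : Prop :=
  ∀ e ∈ atlas F M, ∀ e' ∈ atlas F M, KellerC1On (e' ∘ e.symm) (e.symm.trans e').source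

variable {F M}

/-- `e` is a chart of the `C¹`-structure of `M` (it belongs to the maximal atlas): the transitions
between `e` and the charts of the given atlas are Keller `C¹` in both directions. -/
def IsC1Chart (e : OpenPartialHomeomorph M F) : Prop :=
  ∀ e' ∈ atlas F M, KellerC1On (e' ∘ e.symm) (e.symm.trans e').source ∧
    KellerC1On (e ∘ e'.symm) (e'.symm.trans e).source

/-- The coordinate change of tangent vectors at `x` from the chart `e` to the chart `e'`, the
derivative of `e' ∘ e⁻¹` at `e x`.

As in Mathlib's `TangentSpace`, the tangent space `T_x M` is modelled by `F`: a tangent vector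
at `x` is represented by its coordinates in the preferred chart `chartAt F x`. Hence
`tangentChange e (chartAt F x) x` sends the coordinates of a tangent vector in the chart `e` to
the tangent vector itself and `tangentChange (chartAt F x) e x` is its inverse. -/
def tangentChange (e e' : OpenPartialHomeomorph M F) (x : M) : F →L[ℝ] F :=
  dirDeriv (e' ∘ e.symm) (e x)

variable (F M) in
/-- A graded Finsler structure on `T M`: an increasing sequence of functions `‖·‖ₙ` on `T M`,
with `seminorm n x` the restriction of the `n`-th one to `T_x M`. -/
structure FinslerStructure where
  seminorm : ℕ → M → Seminorm ℝ F
  /-- The structure is graded. -/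
  mono : ∀ n x v, seminorm n x v ≤ seminorm (n + 1) x v
  /-- Each `‖·‖ₙ` is continuous on `T M`, expressed in the charts `U × F ≃ T M|_U`. -/
  continuousOn : ∀ e : OpenPartialHomeomorph M F, IsC1Chart e → ∀ n,
    ContinuousOn (fun p : M × F => seminorm n p.1 (tangentChange e (chartAt F p.1) p.1 p.2))
      (e.source ×ˢ univ)
  /-- On each `T_x M` the seminorms define the topology. -/
  withSeminorms : ∀ x : M, WithSeminorms (fun n => seminorm n x : SeminormFamily ℝ F ℕ)
  /-- Around each point there is a chart in which the seminorms at nearby points are comparable,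
  with a constant `k > 1` as close to `1` as desired, uniformly in `n`. -/
  comparable : ∀ x : M, ∃ e : OpenPartialHomeomorph M F, IsC1Chart e ∧ x ∈ e.source ∧
    ∀ x₀ ∈ e.source, ∀ k : ℝ, 1 < k → ∀ᶠ w in 𝓝 x₀, ∀ (n : ℕ) (v : F),
      1 / k * seminorm n x₀ (tangentChange e (chartAt F x₀) x₀ v)
          ≤ seminorm n w (tangentChange e (chartAt F w) w v) ∧
        seminorm n w (tangentChange e (chartAt F w) w v)
          ≤ k * seminorm n x₀ (tangentChange e (chartAt F x₀) x₀ v)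

/-- `γ : [a, b] → M` is a `C¹`-curve with velocity `γ' t ∈ T_{γ t} M`: the velocity is the
derivative of the curve (one-sided at the end points), and it is continuous in charts. -/
structure IsC1Curve (γ : ℝ → M) (γ' : ℝ → F) (a b : ℝ) : Prop where
  lt : a < b
  continuousOn : ContinuousOn γ (Icc a b)
  hasVelocity : ∀ t ∈ Icc a b,
    Tendsto (fun s => (s - t)⁻¹ • (chartAt F (γ t) (γ s) - chartAt F (γ t) (γ t)))
      (𝓝[Icc a b \ {t}] t) (𝓝 (γ' t))
  continuousOn_velocity : ∀ e : OpenPartialHomeomorph M F, IsC1Chart e →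
    ContinuousOn (fun t => tangentChange (chartAt F (γ t)) e (γ t) (γ' t))
      (Icc a b ∩ γ ⁻¹' e.source)

/-- `N.PathLength n x y ℓ`: there is a piecewise `C¹`-curve (a finite concatenation of
`C¹`-curves) from `x` to `y` whose length with respect to the `n`-th component is `ℓ`. -/
inductive FinslerStructure.PathLength (N : FinslerStructure F M) (n : ℕ) : M → M → ℝ → Prop
  | refl (x : M) : PathLength N n x x 0
  | cons {y : M} {ℓ : ℝ} (γ : ℝ → M) (γ' : ℝ → F) (a b : ℝ) (hγ : IsC1Curve γ γ' a b)
      (h : PathLength N n (γ b) y ℓ) :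
      PathLength N n (γ a) y ((∫ t in a..b, N.seminorm n (γ t) (γ' t)) + ℓ)

/-- `ρₙ(x, y)`, the infimum of the `n`-th lengths of piecewise `C¹`-curves from `x` to `y`
(on a connected manifold such curves exist for all `x`, `y`). -/
def FinslerStructure.distN (N : FinslerStructure F M) (n : ℕ) (x y : M) : ℝ :=
  sInf {ℓ | N.PathLength n x y ℓ}

/-- The Finsler metric `ρ = ∑ₙ 2⁻ⁿ ρₙ / (1 + ρₙ)`, the sum being indexed from `1` in the usual
notation and from `0` here. -/
def FinslerStructure.rho (N : FinslerStructure F M) (x y : M) : ℝ :=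
  ∑' n : ℕ, 1 / 2 ^ (n + 1) * (N.distN n x y / (1 + N.distN n x y))

/-- The metric `ρ` is complete. -/
def FinslerStructure.IsComplete (N : FinslerStructure F M) : Prop :=
  ∀ u : ℕ → M, (∀ ε > 0, ∃ n₀, ∀ m ≥ n₀, ∀ n ≥ n₀, N.rho (u m) (u n) < ε) →
    ∃ x, Tendsto (fun n => N.rho (u n) x) atTop (𝓝 0)

/-- The distance `ρ(A, B) = inf {ρ(x, y) | x ∈ A, y ∈ B}` of two nonempty sets. -/
def FinslerStructure.setDist (N : FinslerStructure F M) (A B : Set M) : ℝ :=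
  sInf (image2 N.rho A B)

/-! ### Functionals, critical points and the Palais-Smale condition -/

variable (F) in
/-- `φ : M → ℝ` is a (Keller) `C¹`-functional. -/
def IsC1Functional (φ : M → ℝ) : Prop :=
  ∀ e : OpenPartialHomeomorph M F, IsC1Chart e → KellerC1On (φ ∘ e.symm) e.target

variable (F) in
/-- The derivative `φ'(x, ·)` of `φ` on `T_x M`. -/
def funDeriv (φ : M → ℝ) (x : M) : F →L[ℝ] ℝ :=
  dirDeriv (φ ∘ (chartAt F x).symm) (chartAt F x x)

variable (F) in
/-- The set `Cr(φ, c)` of critical points of `φ` at level `c`. -/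
def critAt (φ : M → ℝ) (c : ℝ) : Set M :=
  {x | funDeriv F φ x = 0 ∧ φ x = c}

/-- `B_∞(0_x)`, the intersection of all closed unit semi-balls of `T_x M`. -/
def FinslerStructure.unitBall (N : FinslerStructure F M) (x : M) : Set F :=
  {h | ∀ n, N.seminorm n x h ≤ 1}

/-- The auxiliary function `Φ_φ(x) = inf {φ'(x, h) | h ∈ B_∞(0_x)}`. The set `B_∞(0_x)` is
bounded and contains `0`, so this is the infimum of a nonempty bounded set of reals. -/
def FinslerStructure.auxFun (N : FinslerStructure F M) (φ : M → ℝ) (x : M) : ℝ :=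
  sInf (funDeriv F φ x '' N.unitBall x)

/-- The Palais-Smale condition `(PS)_c` on `M`. -/
def FinslerStructure.PalaisSmale (N : FinslerStructure F M) (φ : M → ℝ) (c : ℝ) : Prop :=
  ∀ m : ℕ → M, Tendsto (fun i => φ (m i)) atTop (𝓝 c) →
    Tendsto (fun i => N.auxFun φ (m i)) atTop (𝓝 0) →
    ∃ (x : M) (k : ℕ → ℕ), StrictMono k ∧ Tendsto (fun i => m (k i)) atTop (𝓝 x)

end Manifold

/-! ### Linking -/

section Linking

variable {T : Type*} [TopologicalSpace T]

/-- The class `H` of continuous maps `h : S → T` that extend `γ : S₀ → T`. -/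
def linkClass (S₀ S : Set T) (γ : C(S₀, T)) : Set C(S, T) :=
  {h | ∀ (x : S) (hx : (x : T) ∈ S₀), h x = γ ⟨x, hx⟩}

/-- `{S₀, S, C}` is a linking set through `γ`. -/
structure IsLinking (S₀ S C : Set T) (γ : C(S₀, T)) : Prop where
  nonempty₀ : S₀.Nonempty
  subset : S₀ ⊆ S
  nonempty : C.Nonempty
  disjoint : range γ ∩ C = ∅
  link : ∀ h ∈ linkClass S₀ S γ, (range h ∩ C).Nonempty

end Linking

end

/-!
The proof is a deformation argument in which the closedness of `φ` provides all the compactness.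

A Hausdorff manifold with a Finsler structure is regular (`FinslerStructure.regularSpace`), hence
metrizable, because it is second countable. On a metrizable space a closed real map has fibres with
compact boundary (`IsClosedMap.isCompact_of_disjoint_interior_fiber`), and interior points of the
fibre `φ = c` are critical since `φ` is constant near them. So a closed set `P` of points at level
`c` none of which is critical is compact. Near each point of `P` a shift in a chart, cut off by a
continuous function, decreases `φ` strictly wherever it moves a point, and maps with this property
can be composed without losing any moved point. Finitely many of them give a continuous
`ψ : M → M` that moves all of `P`, decreases `φ` where it is not the identity, and fixes any
prescribed closed set disjoint from `P` (`IsC1Functional.exists_isDescentMap_of_isCompact`).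

Let `ψ` fix the image of `γ`; then `h ↦ ψ ∘ h` maps the class `H` to itself.
* If `c = inf_C φ`, take for `P` the points of `C` at level `c`. The closure of the image of `γ` is
  disjoint from `C`, because `ρ` is continuous at the diagonal (`FinslerStructure.tendsto_rho`).
  By linking, `ψ⁻¹(C)` contains points at levels arbitrarily close to `c` and none below, so, `φ`
  being closed, it contains a point `y` at level `c`. As `φ (ψ y) ≥ c`, the point `y ∈ C` is not
  moved, a contradiction.
* If `c > inf_C φ`, then `φ ∘ γ` is bounded by some `b < c`. Take for `P` the whole fibre and let
  `ψ` fix `{φ ≤ b}`. Compactness of the fibre and closedness of `φ` show that `ψ` brings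
  `{φ < c + ε}` into a sublevel set strictly below `c`, which contradicts the choice of `c`.

The regularity of `M` and the continuity of `ρ` rest on the differential calculus of Keller `C¹`
maps: these are Hadamard differentiable (`KellerC1On.hasHadamardDeriv`), which yields the chain rule
for coordinate changes (`tangentChange_tangentChange`) and estimates of straight lines of one chart
in another one.
-/

/-! ### Differential calculus of Keller `C¹` maps -/

section Calculus

variable {E G H : Type*}
  [AddCommGroup E] [Module ℝ E] [TopologicalSpace E]
  [AddCommGroup G] [Module ℝ G] [TopologicalSpace G]
  [AddCommGroup H] [Module ℝ H] [TopologicalSpace H]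

/-- The mean value inequality for a continuous seminorm and a differentiable curve. -/
theorem Seminorm.map_sub_le_of_deriv_le [IsTopologicalAddGroup G] [ContinuousSMul ℝ G]
    {p : Seminorm ℝ G} (hp : Continuous p) {u u' : ℝ → G} {a b C : ℝ} (hab : a ≤ b)
    (hu : ContinuousOn u (Icc a b))
    (hu' : ∀ t ∈ Ico a b, Tendsto (fun τ : ℝ => τ⁻¹ • (u (t + τ) - u t)) (𝓝[≠] 0) (𝓝 (u' t)))
    (hC : ∀ t ∈ Ico a b, p (u' t) ≤ C) : p (u b - u a) ≤ C * (b - a) := by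
  have key := image_le_of_liminf_slope_right_le_deriv_boundary (f := fun t => p (u t - u a))
    (a := a) (b := b) (B := fun t => C * (t - a)) (B' := fun _ => C)
    (hp.comp_continuousOn (hu.sub continuousOn_const)) (by simp) (by fun_prop)
    (fun x _ => by
      simpa using (((hasDerivWithinAt_id x (Ici x)).sub_const a).const_mul C)) ?_
  · exact key ⟨hab, le_rfl⟩
  intro t ht r hr
  have hlim : Tendsto (fun z : ℝ => p ((z - t)⁻¹ • (u z - u t))) (𝓝[>] t) (𝓝 (p (u' t))) := by
    have h1 : Tendsto (fun z : ℝ => z - t) (𝓝[>] t) (𝓝[≠] 0) := by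
      refine tendsto_nhdsWithin_iff.2 ⟨?_, ?_⟩
      · have : Tendsto (fun z : ℝ => z - t) (𝓝 t) (𝓝 (t - t)) := by
          exact (continuous_id.sub continuous_const).tendsto t
        rw [sub_self] at this
        exact this.mono_left nhdsWithin_le_nhds
      · filter_upwards [self_mem_nhdsWithin] with z hz
        exact sub_ne_zero.2 (ne_of_gt hz)
    have h2 := (hp.tendsto _).comp ((hu' t ht).comp h1)
    refine h2.congr fun z => ?_
    simp
  have hev := hlim.eventually (gt_mem_nhds ((hC t ht).trans_lt hr))
  refine Eventually.frequently ?_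
  filter_upwards [hev, self_mem_nhdsWithin] with z hz hzt
  have hpos : 0 < z - t := sub_pos.2 hzt
  refine lt_of_le_of_lt ?_ hz
  rw [map_smul_eq_mul, slope_def_field, Real.norm_eq_abs, abs_of_pos (inv_pos.2 hpos),
    div_eq_inv_mul]
  refine mul_le_mul_of_nonneg_left ?_ (inv_pos.2 hpos).le
  have := map_add_le_add p (u z - u t) (u t - u a)
  rw [sub_add_sub_cancel] at this
  linarith

/-- Hadamard differentiability: the difference quotients of `f` at `x` converge also along
directions that vary and converge. Unlike the directional derivative, this notion satisfies the
chain rule. -/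
def HasHadamardDeriv (f : E → G) (L : E →L[ℝ] G) (x : E) : Prop :=
  ∀ h : E, Tendsto (fun q : ℝ × E => q.1⁻¹ • (f (x + q.1 • q.2) - f x)) (𝓝[≠] 0 ×ˢ 𝓝 h)
    (𝓝 (L h))

theorem HasHadamardDeriv.hasDirDeriv {f : E → G} {L : E →L[ℝ] G} {x : E}
    (hf : HasHadamardDeriv f L x) : HasDirDeriv f L x := fun h =>
  (hf h).comp (tendsto_id.prodMk tendsto_const_nhds)

theorem HasDirDeriv.dirDeriv_eq [T2Space G] {f : E → G} {L : E →L[ℝ] G} {x : E}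
    (hf : HasDirDeriv f L x) : dirDeriv f x = L := by
  have hex : ∃ L : E →L[ℝ] G, HasDirDeriv f L x := ⟨L, hf⟩
  have hd : dirDeriv f x = hex.choose := by rw [dirDeriv, dif_pos hex]
  rw [hd]
  ext h
  exact tendsto_nhds_unique (hex.choose_spec h) (hf h)

theorem HasHadamardDeriv.comp [ContinuousAdd E] [ContinuousSMul ℝ E] {g : G → H} {f : E → G}
    {L' : G →L[ℝ] H} {L : E →L[ℝ] G} {x : E}
    (hg : HasHadamardDeriv g L' (f x)) (hf : HasHadamardDeriv f L x) :
    HasHadamardDeriv (g ∘ f) (L'.comp L) x := by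
  intro h
  have h1 : Tendsto (fun q : ℝ × E => (q.1, q.1⁻¹ • (f (x + q.1 • q.2) - f x)))
      (𝓝[≠] 0 ×ˢ 𝓝 h) (𝓝[≠] 0 ×ˢ 𝓝 (L h)) := tendsto_fst.prodMk (hf h)
  refine ((hg (L h)).comp h1).congr' ?_
  have hne : ∀ᶠ q : ℝ × E in 𝓝[≠] 0 ×ˢ 𝓝 h, q.1 ≠ 0 :=
    tendsto_fst.eventually (eventually_mem_nhdsWithin (a := (0 : ℝ)) (s := {0}ᶜ))
  filter_upwards [hne] with q hq
  simp [smul_smul, mul_inv_cancel₀ hq]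

theorem HasHadamardDeriv.congr_of_eventuallyEq [ContinuousAdd E] [ContinuousSMul ℝ E]
    {f g : E → G} {L : E →L[ℝ] G} {x : E}
    (hf : HasHadamardDeriv f L x) (hfg : f =ᶠ[𝓝 x] g) : HasHadamardDeriv g L x := by
  intro h
  refine (hf h).congr' ?_
  have h1 : Tendsto (fun q : ℝ × E => x + q.1 • q.2) (𝓝[≠] 0 ×ˢ 𝓝 h) (𝓝 x) := by
    have : Tendsto (fun q : ℝ × E => x + q.1 • q.2) (𝓝 (0, h)) (𝓝 (x + (0 : ℝ) • h)) :=
      (by fun_prop : Continuous fun q : ℝ × E => x + q.1 • q.2).tendsto (0, h)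
    rw [zero_smul, add_zero, nhds_prod_eq] at this
    exact this.mono_left (prod_mono nhdsWithin_le_nhds le_rfl)
  filter_upwards [h1.eventually hfg] with q hq
  rw [hq, hfg.eq_of_nhds]

theorem KellerC1On.hasDirDeriv_dirDeriv [IsTopologicalAddGroup G] [T2Space G] {f : E → G}
    {U : Set E} (hf : KellerC1On f U) {x : E} (hx : x ∈ U) : HasDirDeriv f (dirDeriv f x) x := by
  obtain ⟨L, hL⟩ := hf.hasDirDeriv x hx
  rwa [hL.dirDeriv_eq]

/-- The derivative of a Keller `C¹` map is jointly continuous: a convergent sequence of vectors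
together with its limit is compact, so the convergence of the derivatives is uniform on it. -/
theorem KellerC1On.continuousOn_dirDeriv_apply [IsTopologicalAddGroup G]
    [FirstCountableTopology E] {f : E → G} {U : Set E} (hf : KellerC1On f U) :
    ContinuousOn (fun q : E × E => dirDeriv f q.1 q.2) (U ×ˢ univ) := by
  rintro ⟨x, h⟩ ⟨hx, -⟩
  refine tendsto_of_seq_tendsto fun q hq => ?_
  obtain ⟨hq1, hq2⟩ := tendsto_nhdsWithin_iff.1 hq
  have hx' : Tendsto (fun n => (q n).1) atTop (𝓝[U] x) :=
    tendsto_nhdsWithin_iff.2 ⟨(continuous_fst.tendsto _).comp hq1, hq2.mono fun n hn => hn.1⟩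
  have hh : Tendsto (fun n => (q n).2) atTop (𝓝 h) := (continuous_snd.tendsto _).comp hq1
  have hT := (hf.continuousOn_deriv x hx).tendsto.comp hx'
  have hT0 := hT.sub_const (UniformConvergenceCLM.ofFun (RingHom.id ℝ) G {K : Set E | IsCompact K}
    (dirDeriv f x))
  rw [sub_self] at hT0
  have hdiff : Tendsto (fun n => dirDeriv f (q n).1 (q n).2 - dirDeriv f x (q n).2) atTop
      (𝓝 0) := by
    intro V hV
    have hV' := UniformConvergenceCLM.eventually_nhds_zero_mapsTo (RingHom.id ℝ)
      (𝔖 := {K : Set E | IsCompact K}) (F := G) hh.isCompact_insert_range hV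
    rw [mem_map]
    filter_upwards [hT0.eventually hV'] with n hn
    exact hn (mem_insert_of_mem _ (mem_range_self n))
  have hlim := hdiff.add (((dirDeriv f x).continuous.tendsto h).comp hh)
  rw [zero_add] at hlim
  refine hlim.congr fun n => ?_
  simp

/-- The derivative of `s ↦ f (x + s w)`. -/
theorem HasDirDeriv.tendsto_line {f : E → G} {L : E →L[ℝ] G} {x w : E} {s : ℝ}
    (hf : HasDirDeriv f L (x + s • w)) :
    Tendsto (fun τ : ℝ => τ⁻¹ • (f (x + (s + τ) • w) - f (x + s • w))) (𝓝[≠] 0) (𝓝 (L w)) := by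
  refine (hf w).congr fun τ => ?_
  rw [add_smul, add_assoc]

/-- A Keller `C¹` map is Hadamard differentiable, by the mean value inequality on the segments
`[x, x + τ k]`. -/
theorem KellerC1On.hasHadamardDeriv [IsTopologicalAddGroup E] [ContinuousSMul ℝ E]
    [FirstCountableTopology E] [IsTopologicalAddGroup G] [ContinuousSMul ℝ G]
    [LocallyConvexSpace ℝ G] [T2Space G] {f : E → G} {U : Set E} (hf : KellerC1On f U)
    (hU : IsOpen U) {x : E} (hx : x ∈ U) : HasHadamardDeriv f (dirDeriv f x) x := by
  intro h
  have hws : WithSeminorms (gaugeSeminormFamily ℝ G) := with_gaugeSeminormFamily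
  rw [hws.tendsto_nhds]
  intro i ε hε
  set p := gaugeSeminormFamily ℝ G i with hpdef
  have hp : Continuous p := hws.continuous_seminorm i
  have hcont : ContinuousAt (fun q : E × E => p (dirDeriv f q.1 q.2 - dirDeriv f x h)) (x, h) :=
    (hp.comp_continuousOn (hf.continuousOn_dirDeriv_apply.sub continuousOn_const)).continuousAt
      ((hU.prod isOpen_univ).mem_nhds ⟨hx, mem_univ h⟩)
  have hev : ∀ᶠ q : E × E in 𝓝 (x, h), q.1 ∈ U ∧
      p (dirDeriv f q.1 q.2 - dirDeriv f x h) < ε / 2 := by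
    refine ((continuous_fst.tendsto (x, h)).eventually (hU.mem_nhds hx)).and
      (hcont.eventually (gt_mem_nhds ?_))
    simpa using half_pos hε
  -- By the tube lemma, the estimate holds uniformly along the segments `[x, x + τ k]`.
  have htube : ∀ᶠ q : ℝ × E in 𝓝 (0, h), ∀ s ∈ Icc (0 : ℝ) 1, x + s • (q.1 • q.2) ∈ U ∧
      p (dirDeriv f (x + s • (q.1 • q.2)) q.2 - dirDeriv f x h) < ε / 2 := by
    refine isCompact_Icc.eventually_forall_of_forall_eventually fun s _ => ?_
    have hc : Continuous fun z : (ℝ × E) × ℝ => (x + z.2 • (z.1.1 • z.1.2), z.1.2) := by fun_prop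
    have := hc.tendsto ((0, h), s)
    simp only [zero_smul, smul_zero, add_zero] at this
    exact this.eventually hev
  have hle : (𝓝[≠] (0 : ℝ)) ×ˢ 𝓝 h ≤ 𝓝 (0, h) := by
    rw [nhds_prod_eq]; exact prod_mono nhdsWithin_le_nhds le_rfl
  have hne : ∀ᶠ q : ℝ × E in 𝓝[≠] 0 ×ˢ 𝓝 h, q.1 ≠ 0 :=
    tendsto_fst.eventually (eventually_mem_nhdsWithin (a := (0 : ℝ)) (s := {0}ᶜ))
  filter_upwards [hle htube, hne] with q hq hq0
  obtain ⟨τ, k⟩ := q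
  simp only at hq hq0 ⊢
  have hmv := Seminorm.map_sub_le_of_deriv_le (p := p) hp (a := 0) (b := 1) (C := ε / 2)
    (u := fun s => τ⁻¹ • (f (x + s • (τ • k)) - f x) - s • dirDeriv f x h)
    (u' := fun s => dirDeriv f (x + s • (τ • k)) k - dirDeriv f x h) zero_le_one ?_ ?_
    (fun t ht => (hq t (Ico_subset_Icc_self ht)).2.le)
  · simp only [one_smul, zero_smul, add_zero, sub_self, smul_zero, sub_zero, mul_one] at hmv
    linarith
  · refine ContinuousOn.sub (ContinuousOn.const_smul (ContinuousOn.sub ?_ continuousOn_const) _)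
      (by fun_prop)
    exact hf.continuousOn.comp (by fun_prop) fun s hs => (hq s hs).1
  · intro s hs
    have hd := (hf.hasDirDeriv_dirDeriv (hq s (Ico_subset_Icc_self hs)).1).tendsto_line
    have hd2 := (hd.const_smul τ⁻¹).sub_const (dirDeriv f x h)
    have hk : τ⁻¹ • dirDeriv f (x + s • (τ • k)) (τ • k) = dirDeriv f (x + s • (τ • k)) k := by
      rw [map_smul, inv_smul_smul₀ hq0]
    rw [hk] at hd2
    refine hd2.congr' ?_
    filter_upwards [self_mem_nhdsWithin] with σ hσ
    have hσ' : σ ≠ 0 := hσ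
    have : dirDeriv f x h = σ⁻¹ • σ • dirDeriv f x h := by
      rw [smul_smul, inv_mul_cancel₀ hσ', one_smul]
    rw [smul_comm τ⁻¹ σ⁻¹]
    nth_rewrite 1 [this]
    rw [← smul_sub]
    congr 1
    rw [add_smul s σ (dirDeriv f x h), smul_sub, smul_sub, smul_sub]
    abel

end Calculus

/-! ### Charts and coordinate changes of tangent vectors -/

section Charts

variable {F : Type*} [AddCommGroup F] [Module ℝ F] [TopologicalSpace F] [IsTopologicalAddGroup F]
  {M : Type*} [TopologicalSpace M]

theorem IsKellerC1Manifold.isC1Chart_chartAt [ChartedSpace F M] (hM : IsKellerC1Manifold F M)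
    (x : M) :
    IsC1Chart (chartAt F x) := fun e' he' =>
  ⟨hM _ (chart_mem_atlas F x) e' he', hM e' he' _ (chart_mem_atlas F x)⟩

theorem HasHadamardDeriv.comp_chart [ContinuousSMul ℝ F] {e e' : OpenPartialHomeomorph M F}
    {x : M} {A B : F →L[ℝ] F} (e'' : OpenPartialHomeomorph M F) (hx : x ∈ e.source)
    (hx' : x ∈ e'.source)
    (hA : HasHadamardDeriv (e' ∘ e.symm) A (e x))
    (hB : HasHadamardDeriv (e'' ∘ e'.symm) B (e' x)) :
    HasHadamardDeriv (e'' ∘ e.symm) (B.comp A) (e x) := by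
  have hex : (e' ∘ e.symm) (e x) = e' x := by simp [e.left_inv hx]
  rw [← hex] at hB
  refine (hB.comp hA).congr_of_eventuallyEq ?_
  filter_upwards [(e.tendsto_symm hx).eventually (e'.open_source.mem_nhds hx')] with y hy
  simp [e'.left_inv hy]

theorem tangentChange_self [ContinuousSMul ℝ F] [T2Space F]
    {e : OpenPartialHomeomorph M F} {x : M} (hx : x ∈ e.source) (v : F) :
    tangentChange e e x v = v := by
  have hid : HasHadamardDeriv (id : F → F) (ContinuousLinearMap.id ℝ F) (e x) := by
    intro h
    refine Tendsto.congr' ?_ tendsto_snd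
    have hne : ∀ᶠ q : ℝ × F in 𝓝[≠] 0 ×ˢ 𝓝 h, q.1 ≠ 0 :=
      tendsto_fst.eventually (eventually_mem_nhdsWithin (a := (0 : ℝ)) (s := {0}ᶜ))
    filter_upwards [hne] with q hq
    simp [inv_smul_smul₀ hq]
  have h2 : HasHadamardDeriv (e ∘ e.symm) (ContinuousLinearMap.id ℝ F) (e x) := by
    refine hid.congr_of_eventuallyEq ?_
    filter_upwards [e.open_target.mem_nhds (e.map_source hx)] with y hy
    simp [e.right_inv hy]
  rw [tangentChange, h2.hasDirDeriv.dirDeriv_eq]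
  rfl

variable [ContinuousSMul ℝ F] [LocallyConvexSpace ℝ F] [T2Space F] [FirstCountableTopology F]
  [ChartedSpace F M]

/-- The transition between any two charts of the maximal atlas is Hadamard differentiable: it
factors locally through a chart of the given atlas. -/
theorem IsC1Chart.hasHadamardDeriv {e e' : OpenPartialHomeomorph M F} (he : IsC1Chart e)
    (he' : IsC1Chart e') {x : M} (hx : x ∈ e.source) (hx' : x ∈ e'.source) :
    HasHadamardDeriv (e' ∘ e.symm) (tangentChange e e' x) (e x) := by
  have hc := mem_chart_source F x
  have h1 : HasHadamardDeriv (chartAt F x ∘ e.symm) _ (e x) :=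
    (he _ (chart_mem_atlas F x)).1.hasHadamardDeriv (e.symm.trans _).open_source
      (by simp [hx, e.left_inv hx])
  have h2 : HasHadamardDeriv (e' ∘ (chartAt F x).symm) _ (chartAt F x x) :=
    (he' _ (chart_mem_atlas F x)).2.hasHadamardDeriv ((chartAt F x).symm.trans _).open_source
      (by simp [hx'])
  have h3 := HasHadamardDeriv.comp_chart e' hx hc h1 h2
  rwa [tangentChange, h3.hasDirDeriv.dirDeriv_eq]

theorem tangentChange_tangentChange {e e' e'' : OpenPartialHomeomorph M F} (he : IsC1Chart e)
    (he' : IsC1Chart e') (he'' : IsC1Chart e'') {x : M} (hx : x ∈ e.source) (hx' : x ∈ e'.source)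
    (hx'' : x ∈ e''.source) (v : F) :
    tangentChange e' e'' x (tangentChange e e' x v) = tangentChange e e'' x v := by
  have h := HasHadamardDeriv.comp_chart e'' hx hx' (he.hasHadamardDeriv he' hx hx')
    (he'.hasHadamardDeriv he'' hx' hx'')
  conv_rhs => rw [tangentChange, h.hasDirDeriv.dirDeriv_eq]
  rfl

theorem continuousOn_tangentChange_apply {e e' : OpenPartialHomeomorph M F}
    (he : IsC1Chart e) (he' : IsC1Chart e') (hM : IsKellerC1Manifold F M) (v : F) :
    ContinuousOn (fun w => tangentChange e e' w v) (e.source ∩ e'.source) := by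
  rintro x ⟨hx, hx'⟩
  refine ContinuousAt.continuousWithinAt ?_
  set c := chartAt F x with hcdef
  have hc : x ∈ c.source := mem_chart_source F x
  have hC1 : IsC1Chart c := hM.isC1Chart_chartAt x
  have h1 : ContinuousAt (fun w => tangentChange e c w v) x := by
    have hk := (he c (chart_mem_atlas F x)).1.continuousOn_dirDeriv_apply.continuousAt
      (x := (e x, v)) (((e.symm.trans c).open_source.prod isOpen_univ).mem_nhds
        (by simp [hx, e.left_inv hx, hc]))
    exact ContinuousAt.comp (f := fun w => (e w, v)) hk
      ((e.continuousAt hx).prodMk continuousAt_const)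
  have h2 : ContinuousAt (fun w => tangentChange c e' w (tangentChange e c w v)) x := by
    have hk := (he' c (chart_mem_atlas F x)).2.continuousOn_dirDeriv_apply.continuousAt
      (x := (c x, tangentChange e c x v)) (((c.symm.trans e').open_source.prod isOpen_univ).mem_nhds
        (by simp [hc, c.left_inv hc, hx']))
    exact ContinuousAt.comp (f := fun w => (c w, tangentChange e c w v)) hk
      ((c.continuousAt hc).prodMk h1)
  refine h2.congr ?_
  filter_upwards [e.open_source.mem_nhds hx, e'.open_source.mem_nhds hx',
    c.open_source.mem_nhds hc] with w hw hw' hwc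
  exact tangentChange_tangentChange he hC1 he' hw hwc hw' v

/-- The velocity, in the chart `e'`, of a curve that is a straight line in the chart `e`. -/
theorem IsC1Chart.tendsto_line {e e' : OpenPartialHomeomorph M F} (he : IsC1Chart e)
    (he' : IsC1Chart e') {a d : F} {t : ℝ} (ht : a + t • d ∈ e.target)
    (ht' : e.symm (a + t • d) ∈ e'.source) :
    Tendsto (fun τ : ℝ => τ⁻¹ • (e' (e.symm (a + (t + τ) • d)) - e' (e.symm (a + t • d))))
      (𝓝[≠] 0) (𝓝 (tangentChange e e' (e.symm (a + t • d)) d)) := by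
  have h := (he.hasHadamardDeriv he' (e.map_target ht) ht').hasDirDeriv
  rw [e.right_inv ht] at h
  exact h.tendsto_line

end Charts

/-! ### The Finsler seminorms in a chart -/

section Finsler

variable {F : Type*} [AddCommGroup F] [Module ℝ F] [TopologicalSpace F] [IsTopologicalAddGroup F]
  {M : Type*} [TopologicalSpace M] [ChartedSpace F M]

/-- The seminorm `‖·‖ₙˣ` on `T_x M`, read in the chart `e`. -/
noncomputable def FinslerStructure.chartSeminorm (N : FinslerStructure F M)
    (e : OpenPartialHomeomorph M F) (x : M) (n : ℕ) : Seminorm ℝ F :=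
  (N.seminorm n x).comp (tangentChange e (chartAt F x) x).toLinearMap

theorem FinslerStructure.chartSeminorm_apply (N : FinslerStructure F M)
    (e : OpenPartialHomeomorph M F) (x : M) (n : ℕ) (v : F) :
    N.chartSeminorm e x n v = N.seminorm n x (tangentChange e (chartAt F x) x v) := rfl

theorem FinslerStructure.chartSeminorm_mono (N : FinslerStructure F M)
    (e : OpenPartialHomeomorph M F) (x : M) : Monotone (N.chartSeminorm e x) :=
  monotone_nat_of_le_succ fun n _ => N.mono n x _

/-- Around `x` there are a chart and a neighbourhood in which the Finsler seminorms are comparable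
to those at `x` with the constant `2`. -/
theorem FinslerStructure.exists_chart_le_two_mul (N : FinslerStructure F M) (x : M) :
    ∃ e : OpenPartialHomeomorph M F, IsC1Chart e ∧ ∃ W : Set M, IsOpen W ∧ x ∈ W ∧ W ⊆ e.source ∧
      ∀ w ∈ W, ∀ n v, N.chartSeminorm e x n v ≤ 2 * N.chartSeminorm e w n v ∧
        N.chartSeminorm e w n v ≤ 2 * N.chartSeminorm e x n v := by
  obtain ⟨e, he, hx, h⟩ := N.comparable x
  obtain ⟨W, hW, hWo, hxW⟩ := eventually_nhds_iff.1
    ((h x hx 2 one_lt_two).and (e.open_source.mem_nhds hx))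
  refine ⟨e, he, W, hWo, hxW, fun w hw => (hW w hw).2, fun w hw n v => ?_⟩
  obtain ⟨h1, h2⟩ := (hW w hw).1 n v
  simp only [chartSeminorm_apply]
  exact ⟨by linarith, h2⟩

variable [ContinuousSMul ℝ F] [LocallyConvexSpace ℝ F] [T2Space F] [FirstCountableTopology F]

theorem FinslerStructure.chartSeminorm_tangentChange (N : FinslerStructure F M)
    (hM : IsKellerC1Manifold F M) {e e' : OpenPartialHomeomorph M F} (he : IsC1Chart e)
    (he' : IsC1Chart e') {x : M} (hx : x ∈ e.source) (hx' : x ∈ e'.source) (n : ℕ) (v : F) :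
    N.chartSeminorm e' x n (tangentChange e e' x v) = N.chartSeminorm e x n v := by
  rw [chartSeminorm_apply, chartSeminorm_apply, tangentChange_tangentChange he he'
    (hM.isC1Chart_chartAt x) hx hx' (mem_chart_source F x)]

theorem FinslerStructure.withSeminorms_chartSeminorm (N : FinslerStructure F M)
    (hM : IsKellerC1Manifold F M) {e : OpenPartialHomeomorph M F} (he : IsC1Chart e)
    {x : M} (hx : x ∈ e.source) :
    WithSeminorms (N.chartSeminorm e x : SeminormFamily ℝ F ℕ) := by
  have hc := hM.isC1Chart_chartAt x
  have hcx := mem_chart_source F x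
  have hinv : ∀ v, tangentChange (chartAt F x) e x (tangentChange e (chartAt F x) x v) = v :=
    fun v => by rw [tangentChange_tangentChange he hc he hx hcx hx, tangentChange_self hx]
  have hind : IsInducing (tangentChange e (chartAt F x) x).toLinearMap :=
    (Topology.IsEmbedding.of_leftInverse (f := tangentChange (chartAt F x) e x) hinv
      (ContinuousLinearMap.continuous _) (ContinuousLinearMap.continuous _)).isInducing
  exact hind.withSeminorms (N.withSeminorms x)

end Finsler

/-! ### Finsler manifolds are metrizable -/

section Regular

variable {F : Type*} [AddCommGroup F] [Module ℝ F] [UniformSpace F] [IsUniformAddGroup F]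
  [ContinuousSMul ℝ F] [CompleteSpace F]
  {M : Type*} [TopologicalSpace M] [T2Space M]

/-- A curve of small speed does not leave a chart domain: if the velocity in the chart `e` is
bounded by constants `C n` for all the seminorms as long as the curve is in `W`, then the curve
has a limit in `F` at the end of its stay in `W`, and if `C N` is small, the limit belongs to a
ball contained in the image of `W`. -/
theorem OpenPartialHomeomorph.curve_mem_of_speed_le (e : OpenPartialHomeomorph M F) {W : Set M}
    (hWe : W ⊆ e.source) (hWo : IsOpen W) {p : SeminormFamily ℝ F ℕ} (hp : WithSeminorms p)
    {N : ℕ} {x₀ : F} {R : ℝ} (hball : ∀ v, p N (v - x₀) < R → v ∈ e.target ∧ e.symm v ∈ W)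
    {σ : ℝ → M} (hσ : ContinuousOn σ (Icc 0 1)) {u' : ℝ → F}
    (hu' : ∀ t ∈ Icc (0 : ℝ) 1, σ t ∈ W →
      Tendsto (fun τ : ℝ => τ⁻¹ • (e (σ (t + τ)) - e (σ t))) (𝓝[≠] 0) (𝓝 (u' t)))
    {C : ℕ → ℝ} (hC : ∀ t ∈ Icc (0 : ℝ) 1, σ t ∈ W → ∀ n, p n (u' t) ≤ C n)
    (h0 : σ 0 ∈ W) (hR : p N (e (σ 0) - x₀) + C N < R) : ∀ t ∈ Icc (0 : ℝ) 1, σ t ∈ W := by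
  have hC0 : ∀ n, 0 ≤ C n := fun n =>
    (apply_nonneg (p n) _).trans (hC 0 ⟨le_rfl, zero_le_one⟩ h0 n)
  have hlip : ∀ n, ∀ s t : ℝ, 0 ≤ s → s ≤ t → t ≤ 1 → (∀ τ ∈ Icc s t, σ τ ∈ W) →
      p n (e (σ t) - e (σ s)) ≤ C n * (t - s) := by
    intro n s t hs hst ht hW
    have hsub : Icc s t ⊆ Icc 0 1 := Icc_subset_Icc hs ht
    refine Seminorm.map_sub_le_of_deriv_le (p := p n) (u := fun τ => e (σ τ)) (u' := u')
      (hp.continuous_seminorm n) hst ?_ ?_ ?_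
    · exact e.continuousOn.comp (hσ.mono hsub) fun τ hτ => hWe (hW τ hτ)
    · exact fun τ hτ => hu' τ (hsub (Ico_subset_Icc_self hτ)) (hW τ (Ico_subset_Icc_self hτ))
    · exact fun τ hτ => hC τ (hsub (Ico_subset_Icc_self hτ)) (hW τ (Ico_subset_Icc_self hτ)) n
  have hlip' : ∀ n, ∀ T : ℝ, T ≤ 1 → (∀ τ ∈ Ico 0 T, σ τ ∈ W) → ∀ s ∈ Ico 0 T, ∀ t ∈ Ico 0 T,
      p n (e (σ t) - e (σ s)) ≤ C n * |t - s| := by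
    intro n T hT hW s hs t ht
    rcases le_total s t with hst | hst
    · rw [abs_of_nonneg (sub_nonneg.2 hst)]
      exact hlip n s t hs.1 hst (ht.2.le.trans hT) fun τ hτ =>
        hW τ ⟨hs.1.trans hτ.1, hτ.2.trans_lt ht.2⟩
    · rw [abs_sub_comm, abs_of_nonneg (sub_nonneg.2 hst), map_sub_rev]
      exact hlip n t s ht.1 hst (hs.2.le.trans hT) fun τ hτ =>
        hW τ ⟨ht.1.trans hτ.1, hτ.2.trans_lt hs.2⟩
  -- The curve stays in `W` at the end of a half-open interval spent in `W`.
  have hend : ∀ T : ℝ, 0 < T → T ≤ 1 → (∀ τ ∈ Ico 0 T, σ τ ∈ W) → σ T ∈ W := by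
    intro T hT0 hT1 hW
    have hmem : ∀ᶠ s in 𝓝[<] T, s ∈ Ico 0 T := Ico_mem_nhdsLT hT0
    have hcauchy : Cauchy (map (fun s => e (σ s)) (𝓝[<] T)) := by
      rw [cauchy_map_iff]
      refine ⟨inferInstance, ?_⟩
      rw [uniformity_eq_comap_nhds_zero, tendsto_comap_iff, hp.tendsto_nhds]
      intro n ε hε
      have hs : Tendsto (fun q : ℝ × ℝ => C n * |q.2 - q.1|) (𝓝[<] T ×ˢ 𝓝[<] T) (𝓝 0) := by
        have hcts : Continuous fun q : ℝ × ℝ => C n * |q.2 - q.1| := by fun_prop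
        have := hcts.tendsto (T, T)
        simp only [sub_self, abs_zero, mul_zero] at this
        rw [nhds_prod_eq] at this
        exact this.mono_left (prod_mono nhdsWithin_le_nhds nhdsWithin_le_nhds)
      filter_upwards [hs.eventually (gt_mem_nhds hε), tendsto_fst.eventually hmem,
        tendsto_snd.eventually hmem] with q hq h1 h2
      simp only [Function.comp_apply, sub_zero]
      exact (hlip' n T hT1 hW _ h1 _ h2).trans_lt hq
    obtain ⟨y, hy⟩ := CompleteSpace.complete hcauchy
    have hy' : Tendsto (fun s => e (σ s)) (𝓝[<] T) (𝓝 y) := hy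
    have hbound : p N (y - x₀) ≤ p N (e (σ 0) - x₀) + C N := by
      refine le_of_tendsto (((hp.continuous_seminorm N).tendsto _).comp (hy'.sub_const x₀)) ?_
      filter_upwards [hmem] with s hs
      have h1 := hlip' N T hT1 hW 0 ⟨le_rfl, hT0⟩ s hs
      have h2 := map_add_le_add (p N) (e (σ s) - e (σ 0)) (e (σ 0) - x₀)
      rw [sub_add_sub_cancel] at h2
      have h3 : C N * |s - 0| ≤ C N := by
        rw [sub_zero, abs_of_nonneg hs.1]
        exact mul_le_of_le_one_right (hC0 N) (hs.2.le.trans hT1)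
      simp only [Function.comp_apply]
      linarith
    obtain ⟨hyt, hyW⟩ := hball y (hbound.trans_lt hR)
    have hlim1 : Tendsto σ (𝓝[<] T) (𝓝 (e.symm y)) := by
      refine ((e.continuousAt_symm hyt).tendsto.comp hy').congr' ?_
      filter_upwards [hmem] with s hs
      exact e.left_inv (hWe (hW s hs))
    have hlim2 : Tendsto σ (𝓝[<] T) (𝓝 (σ T)) := by
      refine (hσ T ⟨hT0.le, hT1⟩).mono_left ?_
      rw [← nhdsWithin_Ico_eq_nhdsLT hT0]
      exact nhdsWithin_mono _ fun s hs => ⟨hs.1, hs.2.le.trans hT1⟩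
    rwa [tendsto_nhds_unique hlim2 hlim1]
  have hind : Icc (0 : ℝ) 1 ⊆ {t | ∀ τ ∈ Icc 0 t, σ τ ∈ W} := by
    refine IsClosed.Icc_subset_of_forall_mem_nhdsWithin ?_ ?_ ?_
    · refine isClosed_of_closure_subset fun T hT => ?_
      have hT01 : T ∈ Icc (0 : ℝ) 1 := by
        have := closure_mono inter_subset_right hT
        rwa [isClosed_Icc.closure_eq] at this
      have hlt : ∀ τ ∈ Ico 0 T, σ τ ∈ W := by
        intro τ hτ
        obtain ⟨t, ht, htm⟩ := mem_closure_iff.1 hT (Ioi τ) isOpen_Ioi hτ.2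
        exact htm.1 τ ⟨hτ.1, (mem_Ioi.1 ht).le⟩
      refine ⟨fun τ hτ => ?_, hT01⟩
      rcases hτ.2.lt_or_eq with h | h
      · exact hlt τ ⟨hτ.1, h⟩
      · rcases hT01.1.lt_or_eq with hpos | hzero
        · exact h ▸ hend T hpos hT01.2 hlt
        · rw [h, ← hzero]; exact h0
    · intro τ hτ
      rw [le_antisymm hτ.2 hτ.1]
      exact h0
    · rintro T ⟨hT, hT0, hT1⟩
      have hWT : ∀ᶠ τ in 𝓝[Icc 0 1] T, σ τ ∈ W :=
        (hσ T ⟨hT0, hT1.le⟩).eventually (hWo.mem_nhds (hT T ⟨hT0, le_rfl⟩))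
      obtain ⟨δ, hδ, hball'⟩ := Metric.mem_nhdsWithin_iff.1 hWT
      have hmem : Ioo T (min (T + δ) 1) ∈ 𝓝[>] T := Ioo_mem_nhdsGT (lt_min (by linarith) hT1)
      filter_upwards [hmem] with s hs τ hτ
      rcases le_or_gt τ T with h | h
      · exact hT τ ⟨hτ.1, h⟩
      · have hs1 := lt_min_iff.1 hs.2
        refine hball' ⟨?_, hτ.1, hτ.2.trans hs1.2.le⟩
        rw [Metric.mem_ball, Real.dist_eq, abs_of_pos (sub_pos.2 h)]
        linarith [hτ.2, hs1.1]
  exact fun t ht => hind ht t ⟨ht.1, le_rfl⟩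

variable [LocallyConvexSpace ℝ F] [T2Space F] [FirstCountableTopology F] [ChartedSpace F M]

/-- A Hausdorff manifold that carries a Finsler structure is regular. If `y` is in the closure of a
small ball `D` of a chart `e` around `x`, a point of `D` very close to `y` is joined to `y` by a
straight line of a chart around `y`. The Finsler seminorms along this line compare those of the two
charts, so the speed of the line in the chart `e` is small and the line, hence `y`, remains in the
domain of `e`. -/
theorem FinslerStructure.regularSpace (N : FinslerStructure F M) (hM : IsKellerC1Manifold F M) :
    RegularSpace M := by
  refine RegularSpace.of_exists_mem_nhds_isClosed_subset fun x O hO => ?_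
  obtain ⟨e, he, W₀, hW₀, hxW₀, hW₀e, hcomp⟩ := N.exists_chart_le_two_mul x
  set W := W₀ ∩ interior O with hWdef
  have hWo : IsOpen W := hW₀.inter isOpen_interior
  have hxW : x ∈ W := ⟨hxW₀, mem_interior_iff_mem_nhds.2 hO⟩
  have hWe : W ⊆ e.source := inter_subset_left.trans hW₀e
  have hp := N.withSeminorms_chartSeminorm hM he (hWe hxW)
  set p := N.chartSeminorm e x with hpdef
  have hV : e.target ∩ e.symm ⁻¹' W ∈ 𝓝 (e x) :=
    (e.isOpen_inter_preimage_symm hWo).mem_nhds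
      ⟨e.map_source (hWe hxW), by simpa [e.left_inv (hWe hxW)] using hxW⟩
  obtain ⟨s, R, hR, hsub⟩ := (hp.mem_nhds_iff _ _).1 hV
  -- The seminorms increase with the index, so a ball of a single one is contained in the image.
  set n₀ := s.sup id with hn₀
  have hball : ∀ v, p n₀ (v - e x) < R → v ∈ e.target ∧ e.symm v ∈ W := by
    intro v hv
    refine hsub ?_
    rw [Seminorm.mem_ball]
    refine lt_of_le_of_lt ?_ hv
    exact (Finset.sup_le fun i hi => N.chartSeminorm_mono e x (Finset.le_sup (f := id) hi) :
      s.sup p ≤ p n₀) _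
  set D : Set M := {w | w ∈ e.source ∧ p n₀ (e w - e x) < R / 2} with hD
  have hDn : D ∈ 𝓝 x := by
    have hc : ContinuousAt (fun w => p n₀ (e w - e x)) x :=
      ContinuousAt.comp (hp.continuous_seminorm n₀).continuousAt
        ((e.continuousAt (hWe hxW)).sub continuousAt_const)
    filter_upwards [e.open_source.mem_nhds (hWe hxW),
      hc.eventually_lt_const (by simpa using half_pos hR : _ < R / 2)] with w h1 h2
    exact ⟨h1, h2⟩
  refine ⟨closure D, mem_of_superset hDn subset_closure, isClosed_closure, fun y hy => ?_⟩
  suffices y ∈ W from interior_subset this.2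
  obtain ⟨e', he', W', hW', hyW', hWe', hcomp'⟩ := N.exists_chart_le_two_mul y
  have hp' := N.withSeminorms_chartSeminorm hM he' (hWe' hyW')
  set q := N.chartSeminorm e' y with hqdef
  have hV' : {v | v ∈ e'.target ∩ e'.symm ⁻¹' W' ∧ 4 * q n₀ (e' y - v) < R / 2} ∈ 𝓝 (e' y) := by
    have hc : Continuous fun v => 4 * q n₀ (e' y - v) :=
      continuous_const.mul ((hp'.continuous_seminorm n₀).comp (continuous_const.sub continuous_id))
    refine Filter.inter_mem ((e'.isOpen_inter_preimage_symm hW').mem_nhds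
      ⟨e'.map_source (hWe' hyW'), by simpa [e'.left_inv (hWe' hyW')] using hyW'⟩) ?_
    exact hc.continuousAt.eventually (gt_mem_nhds (by simpa using half_pos hR))
  obtain ⟨B, ⟨hB, hBc⟩, hBsub⟩ :=
    (LocallyConvexSpace.convex_basis (𝕜 := ℝ) (e' y)).mem_iff.1 hV'
  simp only [id_eq] at hBsub
  have hnear : e'.source ∩ e' ⁻¹' B ∈ 𝓝 y :=
    Filter.inter_mem (e'.open_source.mem_nhds (hWe' hyW'))
      ((e'.continuousAt (hWe' hyW')).preimage_mem_nhds hB)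
  obtain ⟨z, ⟨hze', hzB⟩, hzD⟩ := mem_closure_iff_nhds.1 hy _ hnear
  set a := e' z with ha
  set d := e' y - e' z with hd
  have hline : ∀ t ∈ Icc (0 : ℝ) 1, a + t • d ∈ B := fun t ht =>
    hBc.add_smul_sub_mem hzB (mem_of_mem_nhds hB) ht
  have hlt : ∀ t ∈ Icc (0 : ℝ) 1, a + t • d ∈ e'.target := fun t ht => (hBsub (hline t ht)).1.1
  have hlW : ∀ t ∈ Icc (0 : ℝ) 1, e'.symm (a + t • d) ∈ W' := fun t ht => (hBsub (hline t ht)).1.2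
  have hz0 : e'.symm (a + (0 : ℝ) • d) = z := by simp [ha, e'.left_inv hze']
  have hy1 : e'.symm (a + (1 : ℝ) • d) = y := by simp [ha, hd, e'.left_inv (hWe' hyW')]
  have hzW : z ∈ W := by
    have := (hball (e z) (hzD.2.trans (half_lt_self hR))).2
    rwa [e.left_inv hzD.1] at this
  have key := e.curve_mem_of_speed_le hWe hWo hp hball (σ := fun t => e'.symm (a + t • d))
    (u' := fun t => tangentChange e' e (e'.symm (a + t • d)) d) (C := fun n => 4 * q n d)
    (e'.symm.continuousOn.comp (by fun_prop) hlt)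
    (fun t ht htW => he'.tendsto_line he (hlt t ht) (hWe htW))
    (fun t ht htW n => ?_) (by simpa only [hz0] using hzW) ?_ 1 ⟨zero_le_one, le_rfl⟩
  · simpa only [hy1] using key
  · have h1 := (hcomp _ htW.1 n (tangentChange e' e (e'.symm (a + t • d)) d)).1
    have h2 := (hcomp' _ (hlW t ht) n d).2
    rw [N.chartSeminorm_tangentChange hM he' he (hWe' (hlW t ht)) (hWe htW)] at h1
    linarith
  · have h1 := (hBsub hzB).2
    have h2 := hzD.2
    rw [hz0]
    linarith

end Regular

/-! ### Continuity of the Finsler metric -/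

section Metric

variable {F : Type*} [AddCommGroup F] [Module ℝ F] [TopologicalSpace F] [IsTopologicalAddGroup F]
  {M : Type*} [TopologicalSpace M] [ChartedSpace F M]

theorem FinslerStructure.PathLength.nonneg {N : FinslerStructure F M} {n : ℕ} {x y : M} {ℓ : ℝ}
    (h : N.PathLength n x y ℓ) : 0 ≤ ℓ := by
  induction h with
  | refl x => exact le_rfl
  | cons γ γ' a b hγ _ ih =>
    exact add_nonneg (intervalIntegral.integral_nonneg hγ.lt.le fun _ _ => apply_nonneg _ _) ih

theorem FinslerStructure.distN_nonneg (N : FinslerStructure F M) (n : ℕ) (x y : M) :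
    0 ≤ N.distN n x y :=
  Real.sInf_nonneg fun _ h => h.nonneg

theorem FinslerStructure.rho_nonneg (N : FinslerStructure F M) (x y : M) : 0 ≤ N.rho x y :=
  tsum_nonneg fun n => by
    have := N.distN_nonneg n x y
    positivity

variable [ContinuousSMul ℝ F] [LocallyConvexSpace ℝ F] [T2Space F] [FirstCountableTopology F]

theorem IsC1Chart.isC1Curve_line (hM : IsKellerC1Manifold F M) {e : OpenPartialHomeomorph M F}
    (he : IsC1Chart e) {a d : F} (hline : ∀ t ∈ Icc (0 : ℝ) 1, a + t • d ∈ e.target) :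
    IsC1Curve (fun t : ℝ => e.symm (a + t • d))
      (fun t => tangentChange e (chartAt F (e.symm (a + t • d))) (e.symm (a + t • d)) d) 0 1 where
  lt := zero_lt_one
  continuousOn := e.symm.continuousOn.comp (by fun_prop) hline
  hasVelocity t ht := by
    have h := he.tendsto_line (hM.isC1Chart_chartAt (e.symm (a + t • d))) (hline t ht)
      (mem_chart_source F _)
    have hsub : Tendsto (fun s : ℝ => s - t) (𝓝[Icc 0 1 \ {t}] t) (𝓝[≠] 0) := by
      refine tendsto_nhdsWithin_iff.2 ⟨?_, ?_⟩
      · have : Tendsto (fun s : ℝ => s - t) (𝓝 t) (𝓝 (t - t)) :=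
          (continuous_id.sub continuous_const).tendsto t
        rw [sub_self] at this
        exact this.mono_left nhdsWithin_le_nhds
      · filter_upwards [self_mem_nhdsWithin] with s hs
        exact sub_ne_zero.2 hs.2
    refine (h.comp hsub).congr fun s => ?_
    simp
  continuousOn_velocity e' he' := by
    have hc := (continuousOn_tangentChange_apply he he' hM d).comp
      (f := fun t : ℝ => e.symm (a + t • d))
      (s := Icc 0 1 ∩ (fun t => e.symm (a + t • d)) ⁻¹' e'.source)
      ((e.symm.continuousOn.comp (by fun_prop) hline).mono inter_subset_left)
      fun t ht => ⟨e.map_target (hline t ht.1), ht.2⟩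
    refine hc.congr fun t ht => ?_
    exact tangentChange_tangentChange he (hM.isC1Chart_chartAt _) he'
      (e.map_target (hline t ht.1)) (mem_chart_source F _) ht.2 d

/-- The metric `ρ` is continuous at the diagonal: straight lines in a chart bound each `ρₙ`. -/
theorem FinslerStructure.tendsto_rho (N : FinslerStructure F M) (hM : IsKellerC1Manifold F M)
    (y : M) : Tendsto (fun z => N.rho z y) (𝓝 y) (𝓝 0) := by
  obtain ⟨e, he, W, hWo, hyW, hWe, hcomp⟩ := N.exists_chart_le_two_mul y
  have hp := N.withSeminorms_chartSeminorm hM he (hWe hyW)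
  have hV : e.target ∩ e.symm ⁻¹' W ∈ 𝓝 (e y) :=
    (e.isOpen_inter_preimage_symm hWo).mem_nhds
      ⟨e.map_source (hWe hyW), by simpa [e.left_inv (hWe hyW)] using hyW⟩
  obtain ⟨B, ⟨hB, hBc⟩, hBsub⟩ := (LocallyConvexSpace.convex_basis (𝕜 := ℝ) (e y)).mem_iff.1 hV
  simp only [id_eq] at hBsub
  have hnear : ∀ᶠ z in 𝓝 y, z ∈ e.source ∧ e z ∈ B :=
    (e.open_source.eventually_mem (hWe hyW)).and ((e.continuousAt (hWe hyW)).preimage_mem_nhds hB)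
  have hbound : ∀ n, ∀ᶠ z in 𝓝 y, N.distN n z y ≤ 2 * N.chartSeminorm e y n (e y - e z) := by
    intro n
    filter_upwards [hnear] with z hz
    have hline : ∀ t ∈ Icc (0 : ℝ) 1, e z + t • (e y - e z) ∈ B := fun t ht =>
      hBc.add_smul_sub_mem hz.2 (mem_of_mem_nhds hB) ht
    have hcurve := he.isC1Curve_line hM fun t ht => (hBsub (hline t ht)).1
    have hend := FinslerStructure.PathLength.cons (N := N) (n := n) _ _ 0 1 hcurve (.refl _)
    simp only [zero_smul, one_smul, add_zero, add_sub_cancel, e.left_inv hz.1,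
      e.left_inv (hWe hyW)] at hend
    refine (csInf_le ⟨0, fun ℓ hℓ => PathLength.nonneg hℓ⟩ hend).trans ?_
    rw [show 2 * N.chartSeminorm e y n (e y - e z) =
      2 * N.chartSeminorm e y n (e y - e z) * |(1 : ℝ) - 0| by norm_num]
    refine (Real.le_norm_self _).trans
      (intervalIntegral.norm_integral_le_of_norm_le_const fun t ht => ?_)
    rw [uIoc_of_le zero_le_one] at ht
    rw [Real.norm_of_nonneg (apply_nonneg _ _), ← chartSeminorm_apply]
    exact (hcomp _ (hBsub (hline t ⟨ht.1.le, ht.2⟩)).2 n _).2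
  have hdist : ∀ n, Tendsto (fun z => N.distN n z y) (𝓝 y) (𝓝 0) := by
    intro n
    have hc : ContinuousAt (fun z => 2 * N.chartSeminorm e y n (e y - e z)) y :=
      continuousAt_const.mul (ContinuousAt.comp (hp.continuous_seminorm n).continuousAt
        (continuousAt_const.sub (e.continuousAt (hWe hyW))))
    refine tendsto_of_tendsto_of_tendsto_of_le_of_le' tendsto_const_nhds (by simpa using hc.tendsto)
      (Eventually.of_forall fun z => N.distN_nonneg n z y) (hbound n)
  have hsum : Summable fun n : ℕ => 1 / 2 ^ (n + 1) * (1 : ℝ) := by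
    have := (summable_geometric_two).mul_left (1 / 2)
    refine this.congr fun n => ?_
    rw [pow_succ, one_div_pow]
    ring
  have h := tendsto_tsum_of_dominated_convergence (𝓕 := 𝓝 y)
    (f := fun z n => 1 / 2 ^ (n + 1) * (N.distN n z y / (1 + N.distN n z y))) (g := fun _ => 0)
    hsum (fun n => ?_) (Eventually.of_forall fun z n => ?_)
  · simpa [FinslerStructure.rho] using h
  · have := ((hdist n).div (tendsto_const_nhds.add (hdist n)) (by norm_num : (1 : ℝ) + 0 ≠ 0))
    simpa using this.const_mul (1 / 2 ^ (n + 1) : ℝ)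
  · have h0 := N.distN_nonneg n z y
    rw [Real.norm_of_nonneg (by positivity)]
    refine mul_le_mul_of_nonneg_left ?_ (by positivity)
    rw [div_le_one (by positivity)]
    linarith

theorem FinslerStructure.disjoint_closure_of_setDist_pos (N : FinslerStructure F M)
    (hM : IsKellerC1Manifold F M) {A C : Set M} (h : 0 < N.setDist A C) :
    Disjoint C (closure A) := by
  refine Set.disjoint_left.2 fun y hyC hyA => ?_
  obtain ⟨z, hz, hzA⟩ := mem_closure_iff_nhds.1 hyA _
    ((N.tendsto_rho hM y).eventually (gt_mem_nhds h))
  refine (show N.rho z y < N.setDist A C from hz).not_ge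
    (csInf_le ⟨0, ?_⟩ (mem_image2_of_mem hzA hyC))
  rintro _ ⟨a, -, b, -, rfl⟩
  exact N.rho_nonneg a b

end Metric

/-! ### Fibres of closed maps -/

section ClosedMap

variable {M : Type*} [TopologicalSpace M]

/-- A closed map into the reals has compact fibre boundaries (Vaĭnšteĭn's lemma): from a sequence
in the boundary of a fibre without cluster points one could pass to nearby points off the fibre
that form a closed set whose image is not closed. -/
theorem IsClosedMap.isCompact_of_disjoint_interior_fiber [TopologicalSpace.MetrizableSpace M]
    {φ : M → ℝ} (hcont : Continuous φ) (hclosed : IsClosedMap φ) {c : ℝ} {P : Set M} (hP : IsClosed P)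
    (hPc : P ⊆ φ ⁻¹' {c}) (hint : Disjoint P (interior (φ ⁻¹' {c}))) : IsCompact P := by
  let := TopologicalSpace.metrizableSpaceMetric M
  refine IsSeqCompact.isCompact fun x hx => ?_
  have hz : ∀ n : ℕ, ∃ z, dist (x n) z < 1 / ((n : ℝ) + 1) ∧
      dist (φ z) c < 1 / ((n : ℝ) + 1) ∧ φ z ≠ c := by
    intro n
    have hε : (0 : ℝ) < 1 / ((n : ℝ) + 1) := Nat.one_div_pos_of_nat
    have hcl : x n ∈ closure (φ ⁻¹' {c})ᶜ := by
      rw [closure_compl]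
      exact fun h => Set.disjoint_left.1 hint (hx n) h
    have hev : ∀ᶠ z in 𝓝 (x n), dist (x n) z < 1 / ((n : ℝ) + 1) ∧
        dist (φ z) c < 1 / ((n : ℝ) + 1) := by
      refine ((by fun_prop : Continuous fun z => dist (x n) z).continuousAt.eventually_lt_const
        (by simpa using hε)).and ((by fun_prop :
          Continuous fun z => dist (φ z) c).continuousAt.eventually_lt_const ?_)
      have : φ (x n) = c := hPc (hx n)
      simpa [this] using hε
    obtain ⟨z, hz1, hz2⟩ := mem_closure_iff_nhds.1 hcl _ hev
    exact ⟨z, hz1.1, hz1.2, hz2⟩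
  choose z hzx hzφ hzc using hz
  obtain ⟨a, ha⟩ : ∃ a, MapClusterPt a atTop z := by
    by_contra! hno
    have hlf : LocallyFinite fun n => ({z n} : Set M) := by
      intro a
      have h := hno a
      simp only [mapClusterPt_iff_frequently, not_forall, not_frequently] at h
      obtain ⟨U, hU, hn⟩ := h
      obtain ⟨k, hk⟩ := eventually_atTop.1 hn
      refine ⟨U, hU, (finite_lt_nat k).subset ?_⟩
      rintro n ⟨w, hw, hwU⟩
      rw [mem_singleton_iff.1 hw] at hwU
      exact not_le.1 fun hkn => hk n hkn hwU
    have hcl : IsClosed (φ '' ⋃ n, {z n}) :=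
      hclosed _ (hlf.isClosed_iUnion fun n => isClosed_singleton)
    have hlim : Tendsto (fun n => φ (z n)) atTop (𝓝 c) := by
      rw [tendsto_iff_dist_tendsto_zero]
      exact squeeze_zero (fun _ => dist_nonneg) (fun n => (hzφ n).le)
        tendsto_one_div_add_atTop_nhds_zero_nat
    obtain ⟨w, hw, hwc⟩ := hcl.mem_of_tendsto hlim
      (Eventually.of_forall fun n => mem_image_of_mem _ (mem_iUnion.2 ⟨n, rfl⟩))
    obtain ⟨n, hn⟩ := mem_iUnion.1 hw
    exact hzc n (mem_singleton_iff.1 hn ▸ hwc)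
  obtain ⟨k, hk, hka⟩ := ha.tendsto_subseq
  have hxa : Tendsto (x ∘ k) atTop (𝓝 a) := by
    refine (tendsto_iff_of_dist ?_).2 hka
    exact squeeze_zero (fun _ => dist_nonneg) (fun n => (hzx (k n)).le)
      (tendsto_one_div_add_atTop_nhds_zero_nat.comp hk.tendsto_atTop)
  exact ⟨a, hP.mem_of_tendsto hxa (Eventually.of_forall fun n => hx _), k, hk, hxa⟩

/-! ### Descent maps -/

/-- A continuous self-map of `M` is a descent map for `φ` if it strictly decreases `φ` at all the
points that it moves. -/
def IsDescentMap (φ : M → ℝ) (ψ : C(M, M)) : Prop :=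
  ∀ y, ψ y = y ∨ φ (ψ y) < φ y

theorem IsDescentMap.le {φ : M → ℝ} {ψ : C(M, M)} (h : IsDescentMap φ ψ) (y : M) :
    φ (ψ y) ≤ φ y := by
  rcases h y with h | h
  · rw [h]
  · exact h.le

/-- A composition of descent maps moves every point that one of the maps moves. -/
theorem IsDescentMap.comp_eq_iff {φ : M → ℝ} {ψ₁ ψ₂ : C(M, M)} (h₁ : IsDescentMap φ ψ₁)
    (h₂ : IsDescentMap φ ψ₂) (y : M) : ψ₂.comp ψ₁ y = y ↔ ψ₁ y = y ∧ ψ₂ y = y := by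
  constructor
  · intro h
    rw [ContinuousMap.comp_apply] at h
    have h1 : ψ₁ y = y := by
      refine (h₁ y).resolve_right fun hlt => ?_
      have := (h₂.le (ψ₁ y)).trans_lt hlt
      rw [h] at this
      exact this.false
    exact ⟨h1, by rwa [h1] at h⟩
  · rintro ⟨h1, h2⟩
    rw [ContinuousMap.comp_apply, h1, h2]

theorem IsDescentMap.comp {φ : M → ℝ} {ψ₁ ψ₂ : C(M, M)} (h₁ : IsDescentMap φ ψ₁)
    (h₂ : IsDescentMap φ ψ₂) : IsDescentMap φ (ψ₂.comp ψ₁) := by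
  intro y
  rw [ContinuousMap.comp_apply]
  rcases h₁ y with h | h
  · rw [h]; exact h₂ y
  · exact Or.inr ((h₂.le _).trans_lt h)

end ClosedMap

section Descent

variable {F : Type*} [AddCommGroup F] [Module ℝ F] [TopologicalSpace F] [IsTopologicalAddGroup F]
  {M : Type*} [TopologicalSpace M] [ChartedSpace F M]

theorem IsC1Functional.continuous {φ : M → ℝ} (hφ : IsC1Functional F φ)
    (hM : IsKellerC1Manifold F M) : Continuous φ := by
  refine continuous_iff_continuousAt.2 fun x => ?_
  have hx := mem_chart_source F x
  have h1 : ContinuousAt (φ ∘ (chartAt F x).symm) (chartAt F x x) :=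
    (hφ _ (hM.isC1Chart_chartAt x)).continuousOn.continuousAt
      ((chartAt F x).open_target.mem_nhds ((chartAt F x).map_source hx))
  refine (h1.comp ((chartAt F x).continuousAt hx)).congr ?_
  filter_upwards [(chartAt F x).open_source.mem_nhds hx] with y hy
  simp [(chartAt F x).left_inv hy]

variable [ContinuousSMul ℝ F]

theorem funDeriv_eq_zero_of_mem_interior {φ : M → ℝ} {c : ℝ} {x : M}
    (hx : x ∈ interior (φ ⁻¹' {c})) : funDeriv F φ x = 0 := by
  set e := chartAt F x with he
  have hxs : x ∈ e.source := mem_chart_source F x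
  have hzero : HasHadamardDeriv (fun _ : F => c) (0 : F →L[ℝ] ℝ) (e x) := fun h => by
    simp
  refine (hzero.congr_of_eventuallyEq ?_).hasDirDeriv.dirDeriv_eq
  filter_upwards [(e.tendsto_symm hxs).eventually (isOpen_interior.mem_nhds hx)] with y hy
  have hy' : e.symm y ∈ φ ⁻¹' {c} := interior_subset hy
  exact (mem_singleton_iff.1 hy').symm

variable [FirstCountableTopology F] [TopologicalSpace.MetrizableSpace M]

/-- Near a point that is not critical, `φ` is decreased by shifts in a chart along a fixed
direction; a cutoff function makes of them a continuous self-map of `M`. -/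
theorem IsC1Functional.exists_isDescentMap_of_ne_zero {φ : M → ℝ} (hφ : IsC1Functional F φ)
    (hM : IsKellerC1Manifold F M) {x : M} (hx : funDeriv F φ x ≠ 0) {Q : Set M} (hQ : IsClosed Q)
    (hxQ : x ∉ Q) :
    ∃ ψ : C(M, M), IsDescentMap φ ψ ∧ (∀ y ∈ Q, ψ y = y) ∧ ∀ᶠ y in 𝓝 x, ψ y ≠ y := by
  classical
  set e := chartAt F x with he
  have hxs : x ∈ e.source := mem_chart_source F x
  set f : F → ℝ := φ ∘ e.symm with hf
  have hfK : KellerC1On f e.target := hφ e (hM.isC1Chart_chartAt x)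
  obtain ⟨v, hv⟩ : ∃ v, dirDeriv f (e x) v < 0 := by
    obtain ⟨w, hw⟩ : ∃ w, dirDeriv f (e x) w ≠ 0 := by
      by_contra! h
      exact hx (ContinuousLinearMap.ext h)
    rcases hw.lt_or_gt with h | h
    · exact ⟨w, h⟩
    · exact ⟨-w, by simpa using h⟩
  have hneg : ∀ᶠ y in 𝓝 (e x), y ∈ e.target ∧ dirDeriv f y v < 0 := by
    have hc : ContinuousAt (fun y => dirDeriv f y v) (e x) :=
      ContinuousAt.comp (f := fun y => (y, v)) (hfK.continuousOn_dirDeriv_apply.continuousAt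
        ((e.open_target.prod isOpen_univ).mem_nhds ⟨e.map_source hxs, mem_univ v⟩))
        (continuousAt_id.prodMk continuousAt_const)
    exact (e.open_target.eventually_mem (e.map_source hxs)).and (hc.eventually_lt_const hv)
  have hseg : ∀ᶠ q : F × ℝ in 𝓝 (e x) ×ˢ 𝓝 0,
      q.1 + q.2 • v ∈ e.target ∧ dirDeriv f (q.1 + q.2 • v) v < 0 := by
    have := (by fun_prop : Continuous fun q : F × ℝ => q.1 + q.2 • v).tendsto (e x, 0)
    rw [zero_smul, add_zero, nhds_prod_eq] at this
    exact this.eventually hneg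
  obtain ⟨pa, hpa, pb, hpb, hab⟩ := eventually_prod_iff.1 hseg
  obtain ⟨δ, hδ, hpb⟩ := Metric.eventually_nhds_iff.1 hpb
  set r := δ / 2 with hr
  have hr0 : 0 < r := half_pos hδ
  have hshift : ∀ y, pa y → ∀ s ∈ Icc 0 r, y + s • v ∈ e.target ∧ dirDeriv f (y + s • v) v < 0 :=
    fun y hy s hs => hab hy (hpb (by
      rw [Real.dist_eq, sub_zero, abs_of_nonneg hs.1]; linarith [hs.2]))
  -- The shifts by at most `r v` decrease `φ` at the points of `U`.
  obtain ⟨U, hU, hUo, hxU⟩ := eventually_nhds_iff.1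
    ((e.open_source.eventually_mem hxs).and (((e.continuousAt hxs).eventually hpa).and
      (hQ.isOpen_compl.eventually_mem hxQ)))
  obtain ⟨D, hD, hDc, hDU⟩ := exists_mem_nhds_isClosed_subset (hUo.mem_nhds hxU)
  obtain ⟨χ, hχc, hχx, hχ1⟩ := CompletelyRegularSpace.completely_regular x (interior D)ᶜ
    isOpen_interior.isClosed_compl (fun h => h (mem_interior_iff_mem_nhds.2 hD))
  set s : M → ℝ := fun y => r * (1 - χ y) with hs
  have hsc : Continuous s := by fun_prop
  have hs_mem : ∀ y, s y ∈ Icc 0 r := fun y =>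
    ⟨mul_nonneg hr0.le (sub_nonneg.2 (χ y).2.2),
      mul_le_of_le_one_right hr0.le (by linarith [(χ y).2.1])⟩
  have hs0 : ∀ y ∉ D, s y = 0 := by
    intro y hy
    have : χ y = 1 := hχ1 fun h => hy (interior_subset h)
    simp [hs, this]
  set ψ : M → M := fun y => if y ∈ U then e.symm (e y + s y • v) else y with hψ
  have hψU : ∀ y ∈ U, ψ y = e.symm (e y + s y • v) := fun y hy => if_pos hy
  have hψ0 : ∀ y, s y = 0 → ψ y = y := by
    intro y hy
    by_cases hyU : y ∈ U
    · rw [hψU y hyU, hy, zero_smul, add_zero, e.left_inv (hU y hyU).1]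
    · exact if_neg hyU
  have hψc : Continuous ψ := by
    refine continuous_iff_continuousAt.2 fun y => ?_
    by_cases hyU : y ∈ U
    · have hy := hU y hyU
      have hc : ContinuousAt (fun y => e.symm (e y + s y • v)) y :=
        ContinuousAt.comp (f := fun y => e y + s y • v)
          (e.continuousAt_symm (hshift _ hy.2.1 _ (hs_mem y)).1)
          ((e.continuousAt hy.1).add (hsc.continuousAt.smul continuousAt_const))
      refine hc.congr ?_
      filter_upwards [hUo.mem_nhds hyU] with z hz
      exact (hψU z hz).symm
    · refine continuousAt_id.congr ?_
      filter_upwards [hDc.isOpen_compl.mem_nhds fun h => hyU (hDU h)] with z hz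
      exact (hψ0 z (hs0 z hz)).symm
  have hlt : ∀ y ∈ U, 0 < s y → φ (ψ y) < φ y := by
    intro y hyU hsy
    have hy := hU y hyU
    have hmem : ∀ τ ∈ Icc 0 (s y), e y + τ • v ∈ e.target ∧ dirDeriv f (e y + τ • v) v < 0 :=
      fun τ hτ => hshift _ hy.2.1 τ ⟨hτ.1, hτ.2.trans (hs_mem y).2⟩
    have hanti : StrictAntiOn (fun τ : ℝ => f (e y + τ • v)) (Icc 0 (s y)) := by
      refine strictAntiOn_of_deriv_neg (convex_Icc 0 (s y)) ?_ ?_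
      · exact hfK.continuousOn.comp (by fun_prop) fun τ hτ => (hmem τ hτ).1
      · intro τ hτ
        have hτ' := hmem τ (interior_subset hτ)
        have hd : HasDerivAt (fun τ : ℝ => f (e y + τ • v)) (dirDeriv f (e y + τ • v) v) τ :=
          hasDerivAt_iff_tendsto_slope_zero.2 (hfK.hasDirDeriv_dirDeriv hτ'.1).tendsto_line
        rw [hd.deriv]
        exact hτ'.2
    have h := hanti ⟨le_rfl, hsy.le⟩ ⟨hsy.le, le_rfl⟩ hsy
    simpa [hf, hψU y hyU, e.left_inv hy.1] using h
  refine ⟨⟨ψ, hψc⟩, fun y => ?_, fun y hy => ?_, ?_⟩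
  · rcases (hs_mem y).1.eq_or_lt with h | h
    · exact Or.inl (hψ0 y h.symm)
    · refine Or.inr (hlt y ?_ h)
      by_contra hyU
      exact h.ne' (hs0 y fun hyD => hyU (hDU hyD))
  · exact hψ0 y (hs0 y fun hyD => (hU y (hDU hyD)).2.2 hy)
  · have hχlt : ∀ᶠ y in 𝓝 x, (χ y : ℝ) < 1 :=
      (continuous_subtype_val.comp hχc).continuousAt.eventually_lt_const (by simp [hχx])
    filter_upwards [hχlt, hUo.mem_nhds hxU] with y hy hyU h
    have := hlt y hyU (mul_pos hr0 (sub_pos.2 hy))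
    rw [show ψ y = y from h] at this
    exact this.false

theorem IsC1Functional.exists_isDescentMap_of_isCompact {φ : M → ℝ} (hφ : IsC1Functional F φ)
    (hM : IsKellerC1Manifold F M) {P Q : Set M} (hP : IsCompact P)
    (hreg : ∀ x ∈ P, funDeriv F φ x ≠ 0) (hQ : IsClosed Q) (hPQ : Disjoint P Q) :
    ∃ ψ : C(M, M), IsDescentMap φ ψ ∧ (∀ y ∈ Q, ψ y = y) ∧ ∀ y ∈ P, ψ y ≠ y := by
  refine hP.induction_on (p := fun P => ∃ ψ : C(M, M), IsDescentMap φ ψ ∧ (∀ y ∈ Q, ψ y = y) ∧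
    ∀ y ∈ P, ψ y ≠ y) ?_ ?_ ?_ ?_
  · exact ⟨ContinuousMap.id M, fun y => Or.inl rfl, fun _ _ => rfl, by simp⟩
  · rintro s t hst ⟨ψ, h1, h2, h3⟩
    exact ⟨ψ, h1, h2, fun y hy => h3 y (hst hy)⟩
  · rintro s t ⟨ψ₁, h1, h2, h3⟩ ⟨ψ₂, h1', h2', h3'⟩
    refine ⟨ψ₂.comp ψ₁, h1.comp h1', fun y hy => (h1.comp_eq_iff h1' y).2 ⟨h2 y hy, h2' y hy⟩,
      fun y hy h => ?_⟩
    obtain ⟨ha, hb⟩ := (h1.comp_eq_iff h1' y).1 h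
    exact hy.elim (fun hs => h3 y hs ha) fun ht => h3' y ht hb
  · intro x hx
    obtain ⟨ψ, h1, h2, h3⟩ :=
      hφ.exists_isDescentMap_of_ne_zero hM (hreg x hx) hQ (Set.disjoint_left.1 hPQ hx)
    exact ⟨{y | ψ y ≠ y}, mem_nhdsWithin_of_mem_nhds h3, ψ, h1, h2, fun y hy => hy⟩

end Descent

/-! ### The minimax level -/

section Linking

variable {M : Type*} [TopologicalSpace M]

theorem comp_mem_linkClass {S₀ S : Set M} {γ : C(S₀, M)} {h : C(S, M)}
    (hh : h ∈ linkClass S₀ S γ) {ψ : C(M, M)} (hψ : ∀ y ∈ range γ, ψ y = y) :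
    ψ.comp h ∈ linkClass S₀ S γ := fun x hx => by
  rw [ContinuousMap.comp_apply, hh x hx]
  exact hψ _ (mem_range_self _)

/-- If the minimax level is a lower bound of `φ` on `C`, a descent map that fixes the boundary
data leaves fixed some point of `C` at the minimax level: the preimage of `C` under the map meets
every sublevel set above the minimax level, and its image under `φ` is closed. -/
theorem IsDescentMap.exists_fixed_of_isLinking {φ : M → ℝ} (hclosed : IsClosedMap φ)
    {S₀ S C : Set M} {γ : C(S₀, M)} (hlink : IsLinking S₀ S C γ) (hC : IsClosed C) {c : ℝ}
    (hcC : ∀ y ∈ C, c ≤ φ y)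
    (hinf : ∀ b > c, ∃ h ∈ linkClass S₀ S γ, ∀ x, φ (h x) < b)
    {ψ : C(M, M)} (hψ : IsDescentMap φ ψ) (hγ : ∀ y ∈ range γ, ψ y = y) :
    ∃ y ∈ C, φ y = c ∧ ψ y = y := by
  have hA : IsClosed (φ '' (ψ ⁻¹' C)) := hclosed _ (hC.preimage ψ.continuous)
  have hmem : c ∈ closure (φ '' (ψ ⁻¹' C)) := by
    refine Metric.mem_closure_iff.2 fun ε hε => ?_
    obtain ⟨h, hh, hlt⟩ := hinf (c + ε) (by linarith)
    obtain ⟨_, ⟨s, rfl⟩, hs⟩ := hlink.link _ (comp_mem_linkClass hh hγ)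
    rw [ContinuousMap.comp_apply] at hs
    refine ⟨φ (h s), mem_image_of_mem _ hs, ?_⟩
    have h1 := (hcC _ hs).trans (hψ.le (h s))
    rw [dist_comm, Real.dist_eq, abs_of_nonneg (sub_nonneg.2 h1)]
    linarith [hlt s]
  rw [hA.closure_eq] at hmem
  obtain ⟨y, hyC, hyc⟩ := hmem
  have hfix : ψ y = y := (hψ y).resolve_right fun hlt => (hlt.trans_eq hyc).not_ge (hcC _ hyC)
  exact ⟨y, by rwa [mem_preimage, hfix] at hyC, hyc, hfix⟩

/-- A descent map that fixes the boundary data leaves fixed some point at the minimax level if the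
fibre of `φ` over this level is compact. Otherwise the map would bring a whole neighbourhood of the
fibre, and since `φ` is closed a whole sublevel set, strictly below the minimax level. -/
theorem IsDescentMap.exists_fixed_of_isCompact {φ : M → ℝ} (hφ : Continuous φ)
    (hclosed : IsClosedMap φ) {S₀ S : Set M} {γ : C(S₀, M)} {c : ℝ}
    (hinf : ∀ b > c, ∃ h ∈ linkClass S₀ S γ, ∀ x, φ (h x) < b)
    (hlb : ∀ h ∈ linkClass S₀ S γ, ∀ b, (∀ x, φ (h x) ≤ b) → c ≤ b)
    (hcomp : IsCompact (φ ⁻¹' {c})) {ψ : C(M, M)} (hψ : IsDescentMap φ ψ)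
    (hγ : ∀ y ∈ range γ, ψ y = y) : ∃ y, φ y = c ∧ ψ y = y := by
  by_contra! hno
  have hlt : ∀ y ∈ φ ⁻¹' {c}, φ (ψ y) < c := fun y hy =>
    ((hψ y).resolve_left (hno y hy)).trans_eq hy
  obtain ⟨b, hbc, hb⟩ : ∃ b < c, ∀ y ∈ φ ⁻¹' {c}, φ (ψ y) < b := by
    rcases (φ ⁻¹' {c}).eq_empty_or_nonempty with hemp | hne
    · exact ⟨c - 1, by linarith, by simp [hemp]⟩
    · obtain ⟨y, hy, hmax⟩ :=
        hcomp.exists_isMaxOn hne (hφ.comp ψ.continuous).continuousOn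
      obtain ⟨b, hb1, hb2⟩ := exists_between (hlt y hy)
      exact ⟨b, hb2, fun z hz => (hmax hz).trans_lt hb1⟩
  have hT : IsClosed (φ '' {y | b ≤ φ (ψ y)}) :=
    hclosed _ (isClosed_le continuous_const (hφ.comp ψ.continuous))
  have hcT : c ∉ φ '' {y | b ≤ φ (ψ y)} := by
    rintro ⟨y, hy, hyc⟩
    exact (hb y hyc).not_ge hy
  obtain ⟨ε, hε, hball⟩ := Metric.isOpen_iff.1 hT.isOpen_compl c hcT
  obtain ⟨h, hh, hhc⟩ := hinf (c + ε) (by linarith)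
  have hle := hlb _ (comp_mem_linkClass hh hγ) (max b (c - ε)) fun x => by
    rw [ContinuousMap.comp_apply]
    rcases le_or_gt b (φ (ψ (h x))) with hbx | hbx
    · refine le_max_of_le_right (le_of_not_gt fun hx => ?_)
      have h1 := hψ.le (h x)
      refine hball ?_ (mem_image_of_mem φ hbx)
      rw [Metric.mem_ball, Real.dist_eq, abs_lt]
      constructor <;> linarith [hhc x]
    · exact le_max_of_le_left hbx.le
  rcases le_max_iff.1 hle with h1 | h1 <;> linarith

end Linking

theorem theorem3p4
    {F : Type*} [AddCommGroup F] [Module ℝ F] [UniformSpace F] [IsUniformAddGroup F]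
    [ContinuousSMul ℝ F] [LocallyConvexSpace ℝ F] [T2Space F]
    [(uniformity F).IsCountablyGenerated] [CompleteSpace F]
    {M : Type*} [TopologicalSpace M] [T2Space M] [SecondCountableTopology M] [ConnectedSpace M]
    [ChartedSpace F M] (hM : IsKellerC1Manifold F M)
    (N : FinslerStructure F M) (hN : N.IsComplete)
    (φ : M → ℝ) (hφ : IsC1Functional F φ) (hclosed : IsClosedMap φ)
    (S₀ S C : Set M) (γ : C(S₀, M)) (hlink : IsLinking S₀ S C γ)
    (hC : IsClosed C) (hdist : 0 < N.setDist (range γ) C)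
    (hLT1 : (⨆ y ∈ range γ, (φ y : EReal)) ≤ ⨅ y ∈ C, (φ y : EReal))
    (c : ℝ) (hc : (c : EReal) = ⨅ h ∈ linkClass S₀ S γ, ⨆ x : S, (φ (h x) : EReal))
    (hPS : N.PalaisSmale φ c) :
    (critAt F φ c).Nonempty ∧
      (⨅ y ∈ C, (φ y : EReal)) ≤ (c : EReal) ∧
      ((c : EReal) = (⨅ y ∈ C, (φ y : EReal)) → (critAt F φ c ∩ C).Nonempty) := by
  have : FirstCountableTopology F := UniformSpace.firstCountableTopology F
  have : RegularSpace M := N.regularSpace hM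
  have hcont : Continuous φ := hφ.continuous hM
  have hinf : ∀ b > c, ∃ h ∈ linkClass S₀ S γ, ∀ x, φ (h x) < b := by
    intro b hb
    have hlt : (⨅ h ∈ linkClass S₀ S γ, ⨆ x : S, (φ (h x) : EReal)) < b := by
      rw [← hc]
      exact EReal.coe_lt_coe_iff.2 hb
    simp only [iInf_lt_iff] at hlt
    obtain ⟨h, hh, hlt⟩ := hlt
    exact ⟨h, hh, fun x => EReal.coe_lt_coe_iff.1
      ((le_iSup (fun x : S => (φ (h x) : EReal)) x).trans_lt hlt)⟩
  have hlb : ∀ h ∈ linkClass S₀ S γ, ∀ b, (∀ x, φ (h x) ≤ b) → c ≤ b := by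
    intro h hh b hb
    rw [← EReal.coe_le_coe_iff, hc]
    exact (iInf₂_le h hh).trans (iSup_le fun x => EReal.coe_le_coe_iff.2 (hb x))
  have hle : (⨅ y ∈ C, (φ y : EReal)) ≤ c := by
    rw [hc]
    refine le_iInf₂ fun h hh => ?_
    obtain ⟨_, ⟨x, rfl⟩, hx⟩ := hlink.link h hh
    exact (iInf₂_le _ hx).trans (le_iSup (fun x : S => (φ (h x) : EReal)) x)
  have hinterior : ∀ P : Set M, (∀ x ∈ P, funDeriv F φ x ≠ 0) →
      Disjoint P (interior (φ ⁻¹' {c})) := fun P hreg =>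
    Set.disjoint_left.2 fun x hx hxi => hreg x hx (funDeriv_eq_zero_of_mem_interior hxi)
  have hfib : IsClosed (φ ⁻¹' {c}) := isClosed_singleton.preimage hcont
  have hcrit : (c : EReal) = (⨅ y ∈ C, (φ y : EReal)) → (critAt F φ c ∩ C).Nonempty := by
    intro hceq
    by_contra hemp
    have hreg : ∀ x ∈ C ∩ φ ⁻¹' {c}, funDeriv F φ x ≠ 0 := fun x hx h0 =>
      hemp ⟨x, ⟨h0, hx.2⟩, hx.1⟩
    have hcompact := hclosed.isCompact_of_disjoint_interior_fiber hcont (hC.inter hfib)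
      inter_subset_right (hinterior _ hreg)
    obtain ⟨ψ, hψ, hfix, hmove⟩ := hφ.exists_isDescentMap_of_isCompact hM hcompact hreg
      (isClosed_closure (s := range γ))
      ((N.disjoint_closure_of_setDist_pos hM hdist).mono_left inter_subset_left)
    have hcC : ∀ y ∈ C, c ≤ φ y := fun y hy => by
      rw [← EReal.coe_le_coe_iff, hceq]
      exact iInf₂_le y hy
    obtain ⟨y, hyC, hyc, hy⟩ := hψ.exists_fixed_of_isLinking hclosed hlink hC hcC hinf
      fun y hy => hfix y (subset_closure hy)
    exact hmove y ⟨hyC, hyc⟩ hy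
  refine ⟨?_, hle, hcrit⟩
  rcases hle.lt_or_eq with hlt | heq
  · by_contra hemp
    have hreg : ∀ x ∈ φ ⁻¹' {c}, funDeriv F φ x ≠ 0 := fun x hx h0 => hemp ⟨x, h0, hx⟩
    have hcompact := hclosed.isCompact_of_disjoint_interior_fiber hcont hfib subset_rfl
      (hinterior _ hreg)
    -- The boundary data lie in a sublevel set strictly below `c`, where nothing needs to move.
    obtain ⟨b, hb1, hb2⟩ := EReal.lt_iff_exists_real_btwn.1 hlt
    have hbc : b < c := EReal.coe_lt_coe_iff.1 hb2
    have hγb : ∀ y ∈ range γ, φ y ≤ b := fun y hy => EReal.coe_le_coe_iff.1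
      ((le_iSup₂ (f := fun y (_ : y ∈ range γ) => (φ y : EReal)) y hy).trans (hLT1.trans hb1.le))
    obtain ⟨ψ, hψ, hfix, hmove⟩ := hφ.exists_isDescentMap_of_isCompact hM hcompact hreg
      (Q := {y | φ y ≤ b}) (isClosed_le hcont continuous_const)
      (Set.disjoint_left.2 fun y hy hyb => hbc.not_ge ((mem_singleton_iff.1 hy).ge.trans hyb))
    obtain ⟨y, hyc, hy⟩ := hψ.exists_fixed_of_isCompact hcont hclosed hinf hlb hcompact
      fun y hy => hfix y (hγb y hy)
    exact hmove y hyc hy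
  · exact (hcrit heq.symm).mono inter_subset_left
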